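/- Let $d\ge 0$, let $\mathbb S^d\subset\mathbb R^{d+1}$ be the unit sphere, let $K\subset\mathbb R^{d+1}$ be compact, let $\tau$ be a Borel probability measure on $K$ (for instance the uniform one), let $\beta>0$, and let $x_1,\dots,x_n\in K$, $n\ge 1$, with empirical measure $\nu_n=\frac1n\sum_{i=1}^n\delta_{x_i}$. Put $\sigma(t)=\max\{0,t\}$. Let $\mathcal P(K)$ be the set of Borel probability measures on $K$, $\mathcal M(X)$ the space of signed Radon measures on $X$, and $|\mu|_{TV}$ the total variation norm. For $f:K\to\mathbb R$ continuous put $Z_f=\int_K e^{-f}\,d\tau$, let $\nu_f$ be the Gibbs measure with density $\frac{d\nu_f}{d\tau}=e^{-f}/Z_f$, and let $H(\nu_n,\nu_f)=-\frac1n\sum_{i=1}^n\log\big(e^{-f(x_i)}/Z_f\big)$. Consider the problems $$\text{(P)}\quad \min_{\nu\in\mathcal P(K)}\ \beta^{-1}D_{KL}(\nu\|\tau)+\max_{\theta\in\mathbb S^d}\Big|\int\sigma(\langle\theta,x\rangle)\,d(\nu-\nu_n)(x)\Big|,$$ $$\text{(D)}\quad \max_{\mu\in\mathcal M(\mathbb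 S^d),\ |\mu|_{TV}\le 1}\ -\frac1n\sum_{i=1}^n\int\sigma(\langle\theta,x_i\rangle)\,d\mu(\theta)-\frac1\beta\log\int_K\exp\Big(-\beta\int\sigma(\langle\theta,x\rangle)\,d\mu(\theta)\Big)d\tau(x).$$ 1. (D) is the Fenchel dual of (P). Precisely, (P) is the problem $\inf_{\rho\in\mathcal M(K)} f(\rho)+g(A\rho)$, where $f(\rho)=\beta^{-1}D_{KL}(\rho\|\tau)$ if $\rho\in\mathcal P(K)$ and $+\infty$ otherwise, $A:\mathcal M(K)\to C(\mathbb S^d)$, $(A\rho)(\theta)=\int\sigma(\langle\theta,x\rangle)\,d\rho(x)$, and $g(\phi)=\max_\theta|\phi(\theta)-\int\sigma(\langle\theta,x\rangle)\,d\nu_n(x)|$; the map sending $\mu\in\mathcal M(\mathbb S^d)$ to the functional $\phi\mapsto\int\phi\,d\mu$ is a bijection onto $C(\mathbb S^d)^*$; and for each $\mu\in\mathcal M(\mathbb S^d)$ the Fenchel dual objective $-f^*(-A^*\mu)-g^*(\mu)$ equals the objective of (D) at $\mu$ if $|\mu|_{TV}\le1$ and $-\infty$ otherwise. 2. (D) is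 the maximum likelihood problem over the ball of radius $\beta$ of $\mathcal F_1$: with $\|f\|_{\mathcal F_1}=\inf\{|\gamma|_{TV}: f(x)=\int\sigma(\langle\theta,x\rangle)\,d\gamma(\theta)\ \forall x\in K\}$ for $f:K\to\mathbb R$ (infinite if there is no such $\gamma$), the functions $f_\mu(x)=\beta\int\sigma(\langle\theta,x\rangle)\,d\mu(\theta)$ with $|\mu|_{TV}\le1$ are exactly those with $\|f\|_{\mathcal F_1}\le\beta$, and the objective of (D) at $\mu$ equals $-\beta^{-1}H(\nu_n,\nu_{f_\mu})$. 3. Strong duality holds: the minimum in (P) and the maximum in (D) are attained, finite and equal. 4. The solution $\nu^\star$ of (P) is unique, and for every solution $\mu^\star$ of (D) it is the Gibbs measure $$\frac{d\nu^\star}{d\tau}(x)=\frac1{Z_\beta}\exp\Big(-\beta\int\sigma(\langle\theta,x\rangle)\,d\mu^\star(\theta)\Big),$$ where $Z_\beta$ is the normalization constant. -/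

import Mathlib

open MeasureTheory

namespace F1Duality

noncomputable section

/-! ### Fenchel duality, for functionals with values in `(-∞, +∞]` -/

/-- The convex conjugate of `f`, evaluated at the linear functional `ℓ`. -/
def fenchelConj {X : Type*} [AddCommGroup X] [Module ℝ X] (f : X → EReal) (ℓ : X →ₗ[ℝ] ℝ) :
    EReal :=
  ⨆ x : X, ((ℓ x : ℝ) : EReal) - f x

/-- The objective `y ↦ -f*(A* y) - g*(-y)`, `y ∈ Y*`, of the Fenchel dual of the problem of
minimizing `f x + g (A x)` over `x ∈ X`. -/
def fenchelDualObjective {X Y : Type*} [AddCommGroup X] [Module ℝ X] [NormedAddCommGroup Y]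
    [NormedSpace ℝ Y] (f : X → EReal) (g : Y → EReal) (A : X →ₗ[ℝ] Y) (y : StrongDual ℝ Y) :
    EReal :=
  - fenchelConj f (y.toLinearMap ∘ₗ A) - fenchelConj g (-y).toLinearMap

/-! ### Neurons and measures -/

/-- The space `ℝ^{d+1}`. -/
abbrev Space (d : ℕ) : Type := EuclideanSpace ℝ (Fin (d + 1))

/-- The unit sphere `𝕊^d` of `ℝ^{d+1}`. -/
abbrev Sph (d : ℕ) : Type := Metric.sphere (0 : Space d) 1

/-- The ReLU neuron `σ(⟨θ, x⟩) = max {0, ⟨θ, x⟩}`. -/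
def neuron {d : ℕ} (θ x : Space d) : ℝ := max 0 (inner ℝ θ x)

/-- The total variation norm `|μ|_TV`. On a compact metric space the signed Radon measures are the
(finite, real) signed Borel measures. -/
def tvNorm {X : Type*} [MeasurableSpace X] (μ : SignedMeasure X) : ℝ :=
  μ.totalVariation.real Set.univ

/-- The function `x ↦ ∫ σ(⟨θ, x⟩) dμ(θ)` on `K`. -/
def network {d : ℕ} {K : Set (Space d)} (μ : SignedMeasure (Sph d)) (x : K) : ℝ :=
  ∫ᵛ θ : Sph d, neuron (θ : Space d) (x : Space d) ∂<•μ

/-- The empirical measure `ν_n = (1/n) ∑ δ_{x_i}`. -/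
def empirical {d : ℕ} {K : Set (Space d)} {n : ℕ} (x : Fin n → K) : Measure K :=
  (n : ENNReal)⁻¹ • ∑ i, Measure.dirac (x i)

/-! ### Gibbs measures and maximum likelihood over the `F_1` ball -/

/-- The partition function `Z_f = ∫ exp (-f) dτ`. -/
def partitionFn {X : Type*} [MeasurableSpace X] (τ : Measure X) (f : X → ℝ) : ℝ :=
  ∫ y, Real.exp (-f y) ∂τ

/-- The density `exp (-f) / Z_f` of the Gibbs measure of energy `f`. -/
def gibbsDensity {X : Type*} [MeasurableSpace X] (τ : Measure X) (f : X → ℝ) (x : X) : ℝ :=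
  Real.exp (-f x) / partitionFn τ f

/-- The Gibbs measure `ν_f` of energy `f` with respect to `τ`. -/
def gibbsMeasure {X : Type*} [MeasurableSpace X] (τ : Measure X) (f : X → ℝ) : Measure X :=
  τ.withDensity fun x => ENNReal.ofReal (gibbsDensity τ f x)

/-- The cross-entropy `H(ν, ν_f) = -∫ log (dν_f/dτ) dν`, with the everywhere defined version
`exp (-f) / Z_f` of the density. -/
def crossEntropy {X : Type*} [MeasurableSpace X] (τ ν : Measure X) (f : X → ℝ) : ℝ :=
  - ∫ x, Real.log (gibbsDensity τ f x) ∂ν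

/-- The `F_1` norm of a function on `K`: the infimum of the total variations of the measures
that represent it. It is `∞` for a function that is not in the space `F_1`. -/
def f1Norm {d : ℕ} {K : Set (Space d)} (f : K → ℝ) : ENNReal :=
  ⨅ (γ : SignedMeasure (Sph d)) (_ : ∀ x, f x = network γ x), ENNReal.ofReal (tvNorm γ)

/-- The closed ball of radius `r` of `F_1`. -/
def f1Ball {d : ℕ} (K : Set (Space d)) (r : ℝ) : Set (K → ℝ) :=
  {f | f1Norm f ≤ ENNReal.ofReal r}

/-! ### The two problems -/

/-- The largest moment discrepancy `max_θ |∫ σ(⟨θ, x⟩) d(ν - ν_n)(x)|`; the maximum is that of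
a continuous function on the compact nonempty sphere. -/
def momentDiscrepancy {d : ℕ} {K : Set (Space d)} (ν νn : Measure K) : ℝ :=
  ⨆ θ : Sph d, |(∫ x : K, neuron (θ : Space d) (x : Space d) ∂ν)
    - ∫ x : K, neuron (θ : Space d) (x : Space d) ∂νn|

/-- The objective `β⁻¹ KL(ν ‖ τ) + max_θ |∫ σ(⟨θ, x⟩) d(ν - ν_n)(x)|`. -/
def primalObjective {d : ℕ} {K : Set (Space d)} (β : ℝ) (τ : Measure K) {n : ℕ} (x : Fin n → K)
    (ν : ProbabilityMeasure K) : EReal :=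
  ((β⁻¹ : ℝ) : EReal) * (InformationTheory.klDiv (ν : Measure K) τ : EReal)
    + ((momentDiscrepancy (ν : Measure K) (empirical x) : ℝ) : EReal)

/-- The objective
`-(1/n) ∑ ∫ σ(⟨θ, x_i⟩) dμ(θ) - (1/β) log ∫ exp (-β ∫ σ(⟨θ, x⟩) dμ(θ)) dτ(x)`. -/
def dualObjective {d : ℕ} {K : Set (Space d)} (β : ℝ) (τ : Measure K) {n : ℕ} (x : Fin n → K)
    (μ : SignedMeasure (Sph d)) : ℝ :=
  -(1 / (n : ℝ)) * ∑ i, network μ (x i)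
    - (1 / β) * Real.log (∫ y : K, Real.exp (-β * network μ y) ∂τ)

/-- The feasible set `|μ|_TV ≤ 1` of the dual problem. -/
def tvBall (d : ℕ) : Set (SignedMeasure (Sph d)) := {μ | tvNorm μ ≤ 1}

/-! ### The first problem as a Fenchel problem on `M(K)` and `C(𝕊^d)` -/

/-- `f(ρ) = β⁻¹ KL(ρ ‖ τ)` if the signed measure `ρ` is a probability measure, `+∞` otherwise (the
infimum is over the at most one probability measure that `ρ` is). -/
def klPart {d : ℕ} {K : Set (Space d)} (β : ℝ) (τ : Measure K) (ρ : SignedMeasure K) : EReal :=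
  ⨅ (ν : ProbabilityMeasure K) (_ : (ν : Measure K).toSignedMeasure = ρ),
    ((β⁻¹ : ℝ) : EReal) * (InformationTheory.klDiv (ν : Measure K) τ : EReal)

/-- `g(φ) = max_θ |φ(θ) - ∫ σ(⟨θ, x⟩) dν_n(x)|` on `C(𝕊^d)`. -/
def momentPart {d : ℕ} {K : Set (Space d)} {n : ℕ} (x : Fin n → K) (φ : C(Sph d, ℝ)) : EReal :=
  ((⨆ θ : Sph d, |φ θ - ∫ y : K, neuron (θ : Space d) (y : Space d) ∂(empirical x)| : ℝ) : EReal)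

theorem continuous_neuron {d : ℕ} :
    Continuous fun p : Space d × Space d => neuron p.1 p.2 := by
  unfold neuron; fun_prop

theorem isFiniteMeasure_variation {X : Type*} [MeasurableSpace X] (ρ : SignedMeasure X) :
    IsFiniteMeasure ρ.variation := by
  rw [← SignedMeasure.totalVariation_eq_variation]
  infer_instance

theorem integrable_of_continuous {X : Type*} [TopologicalSpace X] [CompactSpace X]
    [MeasurableSpace X] [BorelSpace X] (ρ : SignedMeasure X) {φ : X → ℝ} (hφ : Continuous φ) :
    ρ.Integrable φ := by
  have := isFiniteMeasure_variation ρ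
  obtain ⟨C, hC⟩ := (isCompact_range hφ.norm).bddAbove
  exact Integrable.of_bound (hφ.stronglyMeasurable_of_hasCompactSupport
    (HasCompactSupport.of_compactSpace φ)).aestronglyMeasurable C
    (Filter.Eventually.of_forall fun x => hC ⟨x, rfl⟩)

theorem continuous_moment {d : ℕ} {K : Set (Space d)} [CompactSpace K] (ρ : SignedMeasure K) :
    Continuous fun θ : Sph d => ∫ᵛ y : K, neuron (θ : Space d) (y : Space d) ∂<•ρ := by
  have hfin := isFiniteMeasure_variation ρ
  obtain ⟨R, hR⟩ := (isCompact_range (f := fun y : K => ‖(y : Space d)‖)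
    (by fun_prop)).bddAbove
  refine VectorMeasure.continuous_of_dominated (bound := fun _ => R) ?_ ?_ ?_ ?_
  · intro θ
    exact (integrable_of_continuous ρ
      (continuous_neuron.comp (by fun_prop : Continuous fun y : K =>
        ((θ : Space d), (y : Space d))))).aestronglyMeasurable
  · intro θ
    refine Filter.Eventually.of_forall fun y => ?_
    have h1 : ‖(y : Space d)‖ ≤ R := hR ⟨y, rfl⟩
    have h2 : ‖(θ : Space d)‖ = 1 := by simp
    have h3 := abs_real_inner_le_norm (θ : Space d) (y : Space d)
    rw [h2, one_mul] at h3
    have h4 := abs_le.1 h3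
    rw [neuron, Real.norm_of_nonneg (le_max_left _ _)]
    exact max_le ((norm_nonneg _).trans h1) (h4.2.trans h1)
  · exact integrable_const R
  · exact Filter.Eventually.of_forall fun y =>
      continuous_neuron.comp (by fun_prop : Continuous fun θ : Sph d =>
        ((θ : Space d), (y : Space d)))

/-- The linear map `A : M(K) → C(𝕊^d)`, `(A ρ)(θ) = ∫ σ(⟨θ, x⟩) dρ(x)`. -/
def momentMap {d : ℕ} (K : Set (Space d)) [CompactSpace K] :
    SignedMeasure K →ₗ[ℝ] C(Sph d, ℝ) where
  toFun ρ := ⟨fun θ => ∫ᵛ y : K, neuron (θ : Space d) (y : Space d) ∂<•ρ, continuous_moment ρ⟩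
  map_add' ρ₁ ρ₂ := by
    ext θ
    have hc : Continuous fun y : K => neuron (θ : Space d) (y : Space d) :=
      continuous_neuron.comp (by fun_prop : Continuous fun y : K =>
        ((θ : Space d), (y : Space d)))
    exact VectorMeasure.integral_add_vectorMeasure
      (integrable_of_continuous ρ₁ hc) (integrable_of_continuous ρ₂ hc)
  map_smul' c ρ := by
    ext θ
    exact VectorMeasure.integral_smul_vectorMeasure _ c

/-- The continuous linear functional `φ ↦ ∫ φ dμ` on `C(X)` given by a signed measure `μ` on the
compact space `X`. -/
def measureFunctional {X : Type*} [TopologicalSpace X] [CompactSpace X] [MeasurableSpace X]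
    [BorelSpace X] (μ : SignedMeasure X) : StrongDual ℝ C(X, ℝ) :=
  LinearMap.mkContinuous
    { toFun := fun φ => ∫ᵛ x, φ x ∂<•μ
      map_add' := fun φ ψ => VectorMeasure.integral_fun_add
        (integrable_of_continuous μ φ.continuous) (integrable_of_continuous μ ψ.continuous)
      map_smul' := fun c φ => VectorMeasure.integral_fun_smul (μ := μ) (B := (ContinuousLinearMap.lsmul ℝ ℝ).flip) c φ }
    (‖(ContinuousLinearMap.lsmul ℝ ℝ : ℝ →L[ℝ] ℝ →L[ℝ] ℝ).flip‖ * μ.variation.real Set.univ)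
    (fun φ => by
      have := isFiniteMeasure_variation μ
      refine (VectorMeasure.norm_integral_le_of_norm_le_const
        (Filter.Eventually.of_forall fun x => φ.norm_coe_le_norm x)).trans (le_of_eq ?_)
      ring)

end

end F1Duality

namespace F1Duality

/-! ### The dual of the continuous functions on a compact space -/

theorem tvNorm_toSignedMeasure_sub_le {X : Type*} [MeasurableSpace X] (P N : Measure X)
    [IsFiniteMeasure P] [IsFiniteMeasure N] :
    tvNorm (P.toSignedMeasure - N.toSignedMeasure) ≤ P.real Set.univ + N.real Set.univ := by
  have h := VectorMeasure.variation_sub_le (μ := P.toSignedMeasure) (ν := N.toSignedMeasure)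
  rw [Measure.variation_toSignedMeasure, Measure.variation_toSignedMeasure] at h
  rw [tvNorm, SignedMeasure.totalVariation_eq_variation, ← measureReal_add_apply]
  exact ENNReal.toReal_mono (measure_ne_top _ _) (h _)

theorem tvNorm_nonneg {X : Type*} [MeasurableSpace X] (μ : SignedMeasure X) : 0 ≤ tvNorm μ :=
  measureReal_nonneg

theorem tvNorm_smul {X : Type*} [MeasurableSpace X] (c : ℝ) (μ : SignedMeasure X) :
    tvNorm (c • μ) = |c| * tvNorm μ := by
  simp only [tvNorm, SignedMeasure.totalVariation_eq_variation, VectorMeasure.variation_smul]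
  rw [measureReal_nnreal_smul_apply]
  simp

theorem integral_toSignedMeasure_sub {X : Type*} [TopologicalSpace X] [CompactSpace X]
    [MeasurableSpace X] [BorelSpace X] (P N : Measure X) [IsFiniteMeasure P] [IsFiniteMeasure N]
    {φ : X → ℝ} (hφ : Continuous φ) :
    ∫ᵛ x, φ x ∂<•(P.toSignedMeasure - N.toSignedMeasure) = ∫ x, φ x ∂P - ∫ x, φ x ∂N := by
  rw [VectorMeasure.integral_sub_vectorMeasure (integrable_of_continuous _ hφ)
    (integrable_of_continuous _ hφ), VectorMeasure.integral_toSignedMeasure,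
    VectorMeasure.integral_toSignedMeasure]

theorem toSignedMeasure_posPart_sub_negPart {X : Type*} [MeasurableSpace X] (μ : SignedMeasure X) :
    μ.toJordanDecomposition.posPart.toSignedMeasure
      - μ.toJordanDecomposition.negPart.toSignedMeasure = μ :=
  μ.toSignedMeasure_toJordanDecomposition

theorem integral_eq_posPart_sub_negPart {X : Type*} [TopologicalSpace X] [CompactSpace X]
    [MeasurableSpace X] [BorelSpace X] (μ : SignedMeasure X) {φ : X → ℝ} (hφ : Continuous φ) :
    ∫ᵛ x, φ x ∂<•μ = ∫ x, φ x ∂μ.toJordanDecomposition.posPart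
      - ∫ x, φ x ∂μ.toJordanDecomposition.negPart := by
  rw [← integral_toSignedMeasure_sub _ _ hφ, toSignedMeasure_posPart_sub_negPart]

theorem tvNorm_eq_posPart_add_negPart {X : Type*} [MeasurableSpace X] (μ : SignedMeasure X) :
    tvNorm μ = μ.toJordanDecomposition.posPart.real Set.univ
      + μ.toJordanDecomposition.negPart.real Set.univ := by
  rw [tvNorm, SignedMeasure.totalVariation, measureReal_add_apply]

/-- A bounded functional on `C(X)` is the difference of two positive ones whose masses add up to
its norm. -/
theorem exists_nonneg_sub_nonneg {X : Type*} [TopologicalSpace X] [CompactSpace X] [Nonempty X]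
    (L : StrongDual ℝ C(X, ℝ)) :
    ∃ P N : C(X, ℝ) →ₗ[ℝ] ℝ, (∀ f, 0 ≤ f → 0 ≤ P f) ∧ (∀ f, 0 ≤ f → 0 ≤ N f) ∧
      (∀ f, L f = P f - N f) ∧ P 1 + N 1 = ‖L‖ := by
  obtain ⟨x₀⟩ := ‹Nonempty X›
  let E := C(X, ℝ) × C(X, ℝ)
  let F : E →ₗ[ℝ] C(X, ℝ) := LinearMap.fst ℝ _ _
  let S : E →ₗ[ℝ] C(X, ℝ) := LinearMap.snd ℝ _ _
  let ev : C(X, ℝ) →ₗ[ℝ] ℝ := (ContinuousMap.evalCLM ℝ x₀).toLinearMap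
  let Φ : E →ₗ[ℝ] ℝ := (1 / 2 : ℝ) • (L.toLinearMap ∘ₗ (F - S)) + (‖L‖ / 2) • (ev ∘ₗ (F + S))
  have hΦ : ∀ p : E, Φ p = 1 / 2 * L (p.1 - p.2) + ‖L‖ / 2 * (p.1 x₀ + p.2 x₀) := fun p => rfl
  let D : Submodule ℝ E := (Submodule.span ℝ {(1 : C(X, ℝ))}).comap (F + S)
  have hD : ∀ p : E, p ∈ D ↔ ∃ c : ℝ, c • (1 : C(X, ℝ)) = p.1 + p.2 := fun p =>
    Submodule.mem_span_singleton
  obtain ⟨g, hg, hpos⟩ := riesz_extension (PointedCone.positive ℝ E) ⟨D, Φ.domRestrict D⟩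
    (by
      rintro ⟨⟨a, b⟩, hp⟩ h
      obtain ⟨c, hc⟩ := (hD _).1 hp
      have hab : ∀ x, a x + b x = c := fun x => by
        simpa using (DFunLike.congr_fun hc x).symm
      have h0 : (0 : E) ≤ (a, b) := h
      have ha : ∀ x, 0 ≤ a x := fun x => h0.1 x
      have hb : ∀ x, 0 ≤ b x := fun x => h0.2 x
      change 0 ≤ Φ (a, b)
      rw [hΦ]
      have hn : ‖a - b‖ ≤ c := by
        refine (ContinuousMap.norm_le _ (by linarith [hab x₀, ha x₀, hb x₀])).2 fun x => ?_
        rw [ContinuousMap.sub_apply, Real.norm_eq_abs, abs_le]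
        constructor <;> linarith [hab x, ha x, hb x]
      have h1 := (abs_le.1 ((Real.norm_eq_abs _).symm.le.trans (L.le_opNorm (a - b)))).1
      have h2 := mul_le_mul_of_nonneg_left hn (norm_nonneg L)
      simp only [hab x₀]
      linarith)
    (by
      rintro ⟨a, b⟩
      refine ⟨⟨((‖a‖ + ‖b‖) • 1, (‖a‖ + ‖b‖) • 1), (hD _).2 ⟨2 * (‖a‖ + ‖b‖), ?_⟩⟩, ?_⟩
      · ext x; simp; ring
      · change (0 : E) ≤ _
        refine ⟨fun x => ?_, fun x => ?_⟩
        · have := (abs_le.1 (a.norm_coe_le_norm x)).1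
          have := norm_nonneg b
          change 0 ≤ (‖a‖ + ‖b‖) * 1 + a x
          linarith
        · have := (abs_le.1 (b.norm_coe_le_norm x)).1
          have := norm_nonneg a
          change 0 ≤ (‖a‖ + ‖b‖) * 1 + b x
          linarith)
  have hg' : ∀ p : E, p ∈ D → g p = Φ p := fun p hp => hg ⟨p, hp⟩
  refine ⟨g ∘ₗ LinearMap.inl ℝ _ _, g ∘ₗ LinearMap.inr ℝ _ _, fun f hf => hpos _ ?_,
    fun f hf => hpos _ ?_, fun f => ?_, ?_⟩
  · exact (⟨hf, le_rfl⟩ : (0 : E) ≤ (f, 0))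
  · exact (⟨le_rfl, hf⟩ : (0 : E) ≤ (0, f))
  · have h1 := hg' (f, -f) ((hD _).2 ⟨0, by simp⟩)
    have h2 : ((f, -f) : E) = (f, 0) - (0, f) := by simp
    rw [hΦ, h2, map_sub, ← h2] at h1
    change L f = g (f, 0) - g (0, f)
    rw [h1, sub_neg_eq_add, ← two_smul ℝ f, map_smul]
    simp
  · have h1 := hg' (1, 1) ((hD _).2 ⟨2, by rw [two_smul]⟩)
    have h2 : ((1, 1) : E) = (1, 0) + (0, 1) := by simp
    rw [hΦ, h2, map_add, ← h2] at h1
    change g (1, 0) + g (0, 1) = ‖L‖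
    rw [h1, sub_self, map_zero, ContinuousMap.one_apply]
    ring

theorem exists_measure_of_nonneg {X : Type*} [TopologicalSpace X] [CompactSpace X] [T2Space X]
    [MeasurableSpace X] [BorelSpace X] (P : C(X, ℝ) →ₗ[ℝ] ℝ) (hP : ∀ f, 0 ≤ f → 0 ≤ P f) :
    ∃ μ : Measure X, IsFiniteMeasure μ ∧ ∀ f : C(X, ℝ), ∫ x, f x ∂μ = P f := by
  let Λ₀ : CompactlySupportedContinuousMap X ℝ →ₗ[ℝ] ℝ :=
    { toFun := fun f => P f.toContinuousMap
      map_add' := fun f g => P.map_add f.toContinuousMap g.toContinuousMap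
      map_smul' := fun c f => P.map_smul c f.toContinuousMap }
  let Λ : CompactlySupportedContinuousMap X ℝ →ₚ[ℝ] ℝ :=
    PositiveLinearMap.mk₀ Λ₀ fun f hf => hP _ hf
  refine ⟨RealRMK.rieszMeasure Λ, inferInstance, fun f => ?_⟩
  exact RealRMK.integral_rieszMeasure Λ (CompactlySupportedContinuousMap.continuousMapEquiv f)

theorem measureFunctional_apply {X : Type*} [TopologicalSpace X] [CompactSpace X]
    [MeasurableSpace X] [BorelSpace X] (μ : SignedMeasure X) (φ : C(X, ℝ)) :
    measureFunctional μ φ = ∫ᵛ x, φ x ∂<•μ := rfl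

/-- The **Riesz representation theorem** for signed measures, existence. -/
theorem exists_measureFunctional_eq {X : Type*} [TopologicalSpace X] [CompactSpace X] [T2Space X]
    [Nonempty X] [MeasurableSpace X] [BorelSpace X] (L : StrongDual ℝ C(X, ℝ)) :
    ∃ μ : SignedMeasure X, measureFunctional μ = L ∧ tvNorm μ ≤ ‖L‖ := by
  obtain ⟨P, N, hP, hN, hL, hnorm⟩ := exists_nonneg_sub_nonneg L
  obtain ⟨p, _, hp⟩ := exists_measure_of_nonneg P hP
  obtain ⟨m, _, hm⟩ := exists_measure_of_nonneg N hN
  refine ⟨p.toSignedMeasure - m.toSignedMeasure, ?_, ?_⟩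
  · ext φ
    rw [measureFunctional_apply, integral_toSignedMeasure_sub _ _ φ.continuous, hp, hm, hL]
  · refine (tvNorm_toSignedMeasure_sub_le p m).trans ?_
    have h1 := hp 1
    have h2 := hm 1
    simp only [ContinuousMap.one_apply, integral_const, smul_eq_mul, mul_one] at h1 h2
    rw [h1, h2, hnorm]

theorem measureFunctional_injective {X : Type*} [TopologicalSpace X] [CompactSpace X]
    [MeasurableSpace X] [BorelSpace X] [HasOuterApproxClosed X] :
    Function.Injective (measureFunctional : SignedMeasure X → StrongDual ℝ C(X, ℝ)) := by
  intro μ ν h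
  have key : μ.toJordanDecomposition.posPart + ν.toJordanDecomposition.negPart
      = ν.toJordanDecomposition.posPart + μ.toJordanDecomposition.negPart := by
    refine ext_of_forall_integral_eq_of_IsFiniteMeasure fun f => ?_
    have hi : ∀ (m : Measure X) [IsFiniteMeasure m], Integrable f m := fun m _ => f.integrable m
    have h1 := DFunLike.congr_fun h f.toContinuousMap
    rw [measureFunctional_apply, measureFunctional_apply,
      integral_eq_posPart_sub_negPart μ (ContinuousMap.continuous _),
      integral_eq_posPart_sub_negPart ν (ContinuousMap.continuous _)] at h1
    simp only [BoundedContinuousFunction.coe_toContinuousMap] at h1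
    rw [integral_add_measure (hi _) (hi _), integral_add_measure (hi _) (hi _)]
    linarith
  rw [← toSignedMeasure_posPart_sub_negPart μ, ← toSignedMeasure_posPart_sub_negPart ν,
    sub_eq_sub_iff_add_eq_add, ← Measure.toSignedMeasure_add, ← Measure.toSignedMeasure_add]
  simp only [key]

theorem measureFunctional_bijective {X : Type*} [TopologicalSpace X] [CompactSpace X] [T2Space X]
    [Nonempty X] [MeasurableSpace X] [BorelSpace X] [HasOuterApproxClosed X] :
    Function.Bijective (measureFunctional : SignedMeasure X → StrongDual ℝ C(X, ℝ)) :=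
  ⟨measureFunctional_injective, fun L => (exists_measureFunctional_eq L).imp fun _ h => h.1⟩

theorem abs_integral_le_tvNorm {X : Type*} [TopologicalSpace X] [CompactSpace X]
    [MeasurableSpace X] [BorelSpace X] (μ : SignedMeasure X) {φ : X → ℝ} (hφ : Continuous φ)
    {C : ℝ} (hC : ∀ x, |φ x| ≤ C) : |∫ᵛ x, φ x ∂<•μ| ≤ C * tvNorm μ := by
  rw [integral_eq_posPart_sub_negPart μ hφ, tvNorm_eq_posPart_add_negPart, mul_add]
  have h : ∀ (m : Measure X) [IsFiniteMeasure m], |∫ x, φ x ∂m| ≤ C * m.real Set.univ := fun m _ =>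
    norm_integral_le_of_norm_le_const (f := φ) (Filter.Eventually.of_forall hC)
  exact (abs_sub _ _).trans (add_le_add (h _) (h _))

theorem norm_measureFunctional {X : Type*} [TopologicalSpace X] [CompactSpace X] [T2Space X]
    [Nonempty X] [MeasurableSpace X] [BorelSpace X] [HasOuterApproxClosed X]
    (μ : SignedMeasure X) : ‖measureFunctional μ‖ = tvNorm μ := by
  refine le_antisymm ?_ ?_
  · refine ContinuousLinearMap.opNorm_le_bound _ (tvNorm_nonneg μ) fun φ => ?_
    rw [mul_comm]
    exact abs_integral_le_tvNorm μ φ.continuous fun x => φ.norm_coe_le_norm x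
  · obtain ⟨ν, hν, hle⟩ := exists_measureFunctional_eq (measureFunctional μ)
    rwa [measureFunctional_injective hν] at hle

/-- **Fubini's theorem** for a finite measure and a signed measure. -/
theorem integral_integral_signedMeasure_swap {X Y : Type*} [TopologicalSpace X] [CompactSpace X]
    [MeasurableSpace X] [BorelSpace X] [TopologicalSpace Y] [CompactSpace Y] [MeasurableSpace Y]
    [BorelSpace Y] [SecondCountableTopology X] [SecondCountableTopology Y]
    (μ : SignedMeasure X) (ν : Measure Y) [IsFiniteMeasure ν] {k : X → Y → ℝ}
    (hk : Continuous (Function.uncurry k)) (hν : Continuous fun x => ∫ y, k x y ∂ν) :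
    ∫ y, (∫ᵛ x, k x y ∂<•μ) ∂ν = ∫ᵛ x, (∫ y, k x y ∂ν) ∂<•μ := by
  have hs : ∀ y, Continuous fun x => k x y := fun y => hk.comp (by fun_prop : Continuous (·, y))
  have hi : ∀ (m : Measure X) [IsFiniteMeasure m],
      Integrable (Function.uncurry k) (m.prod ν) := fun m _ => by
    obtain ⟨C, hC⟩ := (isCompact_range hk.norm).bddAbove
    exact Integrable.of_bound hk.measurable.aestronglyMeasurable C
      (Filter.Eventually.of_forall fun x => hC ⟨x, rfl⟩)
  simp only [integral_eq_posPart_sub_negPart μ (hs _)]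
  rw [integral_eq_posPart_sub_negPart μ hν, 
    integral_sub (f := fun y => ∫ x, k x y ∂μ.toJordanDecomposition.posPart)
      (g := fun y => ∫ x, k x y ∂μ.toJordanDecomposition.negPart)
      (hi _).integral_prod_right (hi _).integral_prod_right,
    integral_integral_swap (hi _), integral_integral_swap (hi _)]

/-! ### The Gibbs variational principle -/

theorem gibbsMeasure_eq_tilted {X : Type*} [MeasurableSpace X] (τ : Measure X) (f : X → ℝ) :
    gibbsMeasure τ f = τ.tilted fun x => -f x := rfl

section Gibbs

variable {X : Type*} [TopologicalSpace X] [CompactSpace X] [MeasurableSpace X] [BorelSpace X]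
  {τ ν : Measure X} [IsProbabilityMeasure τ] [IsProbabilityMeasure ν] {f : X → ℝ}

theorem integrable_of_continuous_compact (ν : Measure X) [IsFiniteMeasure ν] {f : X → ℝ}
    (hf : Continuous f) : Integrable f ν := by
  obtain ⟨C, hC⟩ := (isCompact_range hf.norm).bddAbove
  exact Integrable.of_bound hf.measurable.aestronglyMeasurable C
    (Filter.Eventually.of_forall fun x => hC ⟨x, rfl⟩)

theorem integrable_exp_neg (ν : Measure X) [IsFiniteMeasure ν] (hf : Continuous f) :
    Integrable (fun x => Real.exp (-f x)) ν :=
  integrable_of_continuous_compact ν (by fun_prop)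

theorem partitionFn_pos (τ : Measure X) [IsProbabilityMeasure τ] (hf : Continuous f) :
    0 < partitionFn τ f :=
  integral_exp_pos (integrable_exp_neg τ hf)

theorem isProbabilityMeasure_gibbsMeasure (τ : Measure X) [IsProbabilityMeasure τ]
    (hf : Continuous f) : IsProbabilityMeasure (gibbsMeasure τ f) :=
  isProbabilityMeasure_tilted (integrable_exp_neg τ hf)

/-- The Gibbs measure, as a probability measure. -/
noncomputable def gibbsProb (τ : Measure X) [IsProbabilityMeasure τ] (f : X → ℝ)
    (hf : Continuous f) : ProbabilityMeasure X :=
  ⟨gibbsMeasure τ f, isProbabilityMeasure_gibbsMeasure τ hf⟩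

theorem klDiv_gibbsMeasure_ne_top (hf : Continuous f) :
    InformationTheory.klDiv (gibbsMeasure τ f) τ ≠ ⊤ := by
  have := isProbabilityMeasure_gibbsMeasure τ hf
  have hac : gibbsMeasure τ f ≪ τ := tilted_absolutelyContinuous τ _
  refine InformationTheory.klDiv_ne_top hac ?_
  have h1 : llr (gibbsMeasure τ f) τ =ᵐ[τ] _ := llr_tilted_left Measure.AbsolutelyContinuous.rfl
    (integrable_exp_neg τ hf) hf.neg.measurable.aemeasurable
  have h2 := hac.ae_le (h1.trans (Filter.EventuallyEq.rfl.add (llr_self τ)))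
  rw [integrable_congr h2]
  exact integrable_of_continuous_compact _ ((hf.neg.sub continuous_const).add continuous_const)

theorem klDiv_gibbsMeasure_right (hf : Continuous f) (h : InformationTheory.klDiv ν τ ≠ ⊤) :
    InformationTheory.klDiv ν (gibbsMeasure τ f) ≠ ⊤ ∧
    (InformationTheory.klDiv ν (gibbsMeasure τ f)).toReal =
      (InformationTheory.klDiv ν τ).toReal + ∫ x, f x ∂ν + Real.log (partitionFn τ f) := by
  have := isProbabilityMeasure_gibbsMeasure τ hf
  obtain ⟨hac, hint⟩ := InformationTheory.klDiv_ne_top_iff.1 h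
  have hexp := integrable_exp_neg τ hf
  have hac' : ν ≪ gibbsMeasure τ f := hac.trans (absolutelyContinuous_tilted hexp)
  have hfν : Integrable (fun x => -f x) ν := integrable_of_continuous_compact ν hf.neg
  refine ⟨InformationTheory.klDiv_ne_top hac' (integrable_llr_tilted_right hac hfν hint hexp), ?_⟩
  have h1 := integral_llr_tilted_right hac hfν hexp hint
  rw [← gibbsMeasure_eq_tilted, integral_neg,
    ← InformationTheory.toReal_klDiv_of_measure_eq hac' (by simp),
    ← InformationTheory.toReal_klDiv_of_measure_eq hac (by simp)] at h1
  rw [h1, partitionFn]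
  ring

theorem toReal_klDiv_gibbsMeasure_left (hf : Continuous f) :
    (InformationTheory.klDiv (gibbsMeasure τ f) τ).toReal
      = -Real.log (partitionFn τ f) - ∫ x, f x ∂gibbsMeasure τ f := by
  have := isProbabilityMeasure_gibbsMeasure τ hf
  have h := (klDiv_gibbsMeasure_right hf (klDiv_gibbsMeasure_ne_top (τ := τ) hf)).2
  rw [InformationTheory.klDiv_self, ENNReal.toReal_zero] at h
  linarith

theorem neg_log_partitionFn_le (hf : Continuous f) (h : InformationTheory.klDiv ν τ ≠ ⊤) :
    -Real.log (partitionFn τ f) ≤ (InformationTheory.klDiv ν τ).toReal + ∫ x, f x ∂ν := by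
  have h1 := (klDiv_gibbsMeasure_right hf h).2
  have h2 : 0 ≤ (InformationTheory.klDiv ν (gibbsMeasure τ f)).toReal := ENNReal.toReal_nonneg
  linarith

theorem eq_gibbsMeasure_of_le (hf : Continuous f) (h : InformationTheory.klDiv ν τ ≠ ⊤)
    (hle : (InformationTheory.klDiv ν τ).toReal + ∫ x, f x ∂ν ≤ -Real.log (partitionFn τ f)) :
    ν = gibbsMeasure τ f := by
  have := isProbabilityMeasure_gibbsMeasure τ hf
  obtain ⟨h1, h2⟩ := klDiv_gibbsMeasure_right hf h
  have h3 : 0 ≤ (InformationTheory.klDiv ν (gibbsMeasure τ f)).toReal := ENNReal.toReal_nonneg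
  rw [← InformationTheory.klDiv_eq_zero_iff, ← (ENNReal.toReal_eq_zero_iff _).trans (or_iff_left h1)]
  linarith

open ProbabilityTheory in
theorem hasDerivAt_log_partitionFn (hf : Continuous f) {k : X → ℝ} (hk : Continuous k) :
    HasDerivAt (fun t : ℝ => Real.log (partitionFn τ fun x => f x + t * k x))
      (-∫ x, k x ∂gibbsMeasure τ f) 0 := by
  have := isProbabilityMeasure_gibbsMeasure τ hf
  have hset : integrableExpSet (fun x => -k x) (gibbsMeasure τ f) = Set.univ :=
    Set.eq_univ_of_forall fun t => integrable_of_continuous_compact _ (by fun_prop)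
  have h0 : (0 : ℝ) ∈ interior (integrableExpSet (fun x => -k x) (gibbsMeasure τ f)) := by
    simp [hset]
  have hd : HasDerivAt (cgf (fun x => -k x) (gibbsMeasure τ f)) (-∫ x, k x ∂gibbsMeasure τ f) 0 := by
    have h1 := (analyticAt_cgf h0).differentiableAt.hasDerivAt
    rwa [deriv_cgf_zero h0, probReal_univ, div_one, integral_neg] at h1
  refine (hd.add_const (Real.log (partitionFn τ f))).congr_of_eventuallyEq
    (Filter.Eventually.of_forall fun t => ?_)
  have h2 : ∫ x, Real.exp (t * -k x) ∂gibbsMeasure τ f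
      = partitionFn τ (fun x => f x + t * k x) / partitionFn τ f := by
    rw [gibbsMeasure_eq_tilted, integral_exp_tilted, partitionFn, partitionFn]
    congr 2
    ext x
    congr 1
    simp only [Pi.add_apply]
    ring
  simp only [cgf, mgf]
  rw [h2, Real.log_div (partitionFn_pos τ (by fun_prop)).ne' (partitionFn_pos τ hf).ne']
  ring

end Gibbs

/-- At a point where `F` is maximal to the right, its derivative is not positive. -/
theorem HasDerivAt.nonpos_of_forall_le {F : ℝ → ℝ} {c : ℝ} (hF : HasDerivAt F c 0)
    (h : ∀ t ∈ Set.Ioc (0 : ℝ) 1, F t ≤ F 0) : c ≤ 0 := by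
  refine le_of_tendsto hF.tendsto_slope_zero_right ?_
  filter_upwards [Ioc_mem_nhdsGT (zero_lt_one (α := ℝ))] with t ht
  rw [zero_add, smul_eq_mul]
  exact mul_nonpos_of_nonneg_of_nonpos (inv_nonneg.2 ht.1.le) (sub_nonpos.2 (h t ht))

/-! ### Networks and moments -/

section Networks

variable {d : ℕ} {K : Set (Space d)}

theorem measureFunctional_add_apply {X : Type*} [TopologicalSpace X] [CompactSpace X]
    [MeasurableSpace X] [BorelSpace X] (μ ν : SignedMeasure X) (φ : C(X, ℝ)) :
    measureFunctional (μ + ν) φ = measureFunctional μ φ + measureFunctional ν φ :=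
  VectorMeasure.integral_add_vectorMeasure (integrable_of_continuous μ φ.continuous)
    (integrable_of_continuous ν φ.continuous)

theorem measureFunctional_smul_apply {X : Type*} [TopologicalSpace X] [CompactSpace X]
    [MeasurableSpace X] [BorelSpace X] (c : ℝ) (μ : SignedMeasure X) (φ : C(X, ℝ)) :
    measureFunctional (c • μ) φ = c * measureFunctional μ φ :=
  VectorMeasure.integral_smul_vectorMeasure _ c

/-- The map that sends `y` to the function `θ ↦ σ(⟨θ, y⟩)` on the sphere. -/
noncomputable def neuronMap (K : Set (Space d)) : C(K, C(Sph d, ℝ)) :=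
  ContinuousMap.curry ⟨fun p : K × Sph d => neuron (p.2 : Space d) (p.1 : Space d),
    continuous_neuron.comp (by fun_prop : Continuous fun p : K × Sph d =>
      ((p.2 : Space d), (p.1 : Space d)))⟩

theorem network_eq (μ : SignedMeasure (Sph d)) (y : K) :
    network μ y = measureFunctional μ (neuronMap K y) := rfl

theorem continuous_network (μ : SignedMeasure (Sph d)) : Continuous (network μ : K → ℝ) := by
  rw [funext (network_eq (K := K) μ)]
  fun_prop

theorem isProbabilityMeasure_empirical {n : ℕ} (hn : 0 < n) (x : Fin n → K) :
    IsProbabilityMeasure (empirical x) := by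
  constructor
  simp only [empirical, Measure.smul_apply, Measure.finsetSum_apply, measure_univ, smul_eq_mul,
    Finset.sum_const, Finset.card_univ, Fintype.card_fin, nsmul_eq_mul, mul_one]
  exact ENNReal.inv_mul_cancel (by exact_mod_cast hn.ne') (ENNReal.natCast_ne_top n)

theorem klPart_toSignedMeasure (β : ℝ) (τ : Measure K) (ν : ProbabilityMeasure K) :
    klPart β τ (ν : Measure K).toSignedMeasure
      = ((β⁻¹ : ℝ) : EReal) * (InformationTheory.klDiv (ν : Measure K) τ : EReal) := by
  refine le_antisymm (iInf_le_of_le ν (iInf_le_of_le rfl le_rfl)) (le_iInf₂ fun ν' h => le_of_eq ?_)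
  rw [Measure.toSignedMeasure_eq_toSignedMeasure_iff] at h
  rw [h]

theorem klPart_eq_top (β : ℝ) (τ : Measure K) {ρ : SignedMeasure K}
    (h : ∀ ν : ProbabilityMeasure K, (ν : Measure K).toSignedMeasure ≠ ρ) :
    klPart β τ ρ = ⊤ :=
  iInf₂_eq_top.2 fun ν hν => absurd hν (h ν)

theorem coe_mul_klDiv_eq_top {β : ℝ} (hβ : 0 < β) {τ ν : Measure K}
    (h : InformationTheory.klDiv ν τ = ⊤) :
    ((β⁻¹ : ℝ) : EReal) * (InformationTheory.klDiv ν τ : EReal) = ⊤ := by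
  rw [h, EReal.coe_ennreal_top, EReal.coe_mul_top_of_pos (inv_pos.2 hβ)]

theorem coe_mul_klDiv {β : ℝ} {τ ν : Measure K} (h : InformationTheory.klDiv ν τ ≠ ⊤) :
    ((β⁻¹ : ℝ) : EReal) * (InformationTheory.klDiv ν τ : EReal)
      = ((β⁻¹ * (InformationTheory.klDiv ν τ).toReal : ℝ) : EReal) := by
  rw [← EReal.coe_ennreal_toReal h, EReal.coe_mul]

variable [CompactSpace K]

theorem momentMap_toSignedMeasure_apply (ν : Measure K) [IsFiniteMeasure ν] (θ : Sph d) :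
    momentMap K ν.toSignedMeasure θ = ∫ y : K, neuron (θ : Space d) (y : Space d) ∂ν :=
  VectorMeasure.integral_toSignedMeasure

theorem integral_network (μ : SignedMeasure (Sph d)) (ν : Measure K) [IsFiniteMeasure ν] :
    ∫ y, network μ y ∂ν = measureFunctional μ (momentMap K ν.toSignedMeasure) := by
  rw [measureFunctional_apply]
  simp only [momentMap_toSignedMeasure_apply]
  refine integral_integral_signedMeasure_swap μ ν (k := fun (θ : Sph d) (y : K) =>
    neuron (θ : Space d) (y : Space d)) (continuous_neuron.comp (by fun_prop :
      Continuous fun p : Sph d × K => ((p.1 : Space d), (p.2 : Space d)))) ?_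
  exact (momentMap K ν.toSignedMeasure).continuous.congr (momentMap_toSignedMeasure_apply ν)

theorem integral_empirical {n : ℕ} (x : Fin n → K) {f : K → ℝ} (hf : Continuous f) :
    ∫ y, f y ∂empirical x = 1 / (n : ℝ) * ∑ i, f (x i) := by
  rw [empirical, integral_smul_measure, integral_finsetSum_measure
    fun i _ => integrable_of_continuous_compact _ hf]
  simp

variable {n : ℕ} {x : Fin n → K}

theorem momentDiscrepancy_eq (ν νn : Measure K) [IsFiniteMeasure ν] [IsFiniteMeasure νn] :
    momentDiscrepancy ν νn
      = ‖momentMap K ν.toSignedMeasure - momentMap K νn.toSignedMeasure‖ := by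
  rw [ContinuousMap.norm_eq_iSup_norm]
  simp only [ContinuousMap.sub_apply, momentMap_toSignedMeasure_apply, Real.norm_eq_abs]
  rfl

theorem momentPart_eq [IsFiniteMeasure (empirical x)] (φ : C(Sph d, ℝ)) :
    momentPart x φ = ((‖φ - momentMap K (empirical x).toSignedMeasure‖ : ℝ) : EReal) := by
  rw [ContinuousMap.norm_eq_iSup_norm]
  simp only [ContinuousMap.sub_apply, momentMap_toSignedMeasure_apply, Real.norm_eq_abs]
  rfl

theorem dualObjective_eq [IsFiniteMeasure (empirical x)] (β : ℝ) (τ : Measure K)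
    (μ : SignedMeasure (Sph d)) :
    dualObjective β τ x μ = -measureFunctional μ (momentMap K (empirical x).toSignedMeasure)
      - β⁻¹ * Real.log (partitionFn τ fun y => β * network μ y) := by
  rw [← integral_network, integral_empirical x (continuous_network μ), dualObjective, partitionFn]
  simp only [neg_mul, one_div]

theorem dualObjective_eq_neg_crossEntropy [IsProbabilityMeasure (empirical x)] {β : ℝ}
    (hβ : 0 < β) (τ : Measure K) [IsProbabilityMeasure τ] (μ : SignedMeasure (Sph d)) :
    dualObjective β τ x μ
      = -(β⁻¹ * crossEntropy τ (empirical x) fun y => β * network μ y) := by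
  have hc : Continuous fun y : K => β * network μ y := (continuous_network μ).const_mul β
  have hZ := partitionFn_pos τ hc
  simp only [crossEntropy, gibbsDensity, Real.log_div (Real.exp_ne_zero _) hZ.ne', Real.log_exp]
  rw [integral_sub (integrable_of_continuous_compact _ (by fun_prop)) (integrable_const _),
    integral_neg,
    integral_const_mul, integral_network, dualObjective_eq]
  simp only [integral_const, probReal_univ, one_smul]
  field_simp

/-! ### The first problem as a Fenchel problem -/

theorem klPart_add_momentPart [IsFiniteMeasure (empirical x)] (β : ℝ) (τ : Measure K)
    (ν : ProbabilityMeasure K) :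
    klPart β τ (ν : Measure K).toSignedMeasure
      + momentPart x (momentMap K (ν : Measure K).toSignedMeasure) = primalObjective β τ x ν := by
  rw [klPart_toSignedMeasure, momentPart_eq, primalObjective, momentDiscrepancy_eq]

theorem klPart_add_momentPart_eq_top (β : ℝ) (τ : Measure K) {ρ : SignedMeasure K}
    (h : ∀ ν : ProbabilityMeasure K, (ν : Measure K).toSignedMeasure ≠ ρ) :
    klPart β τ ρ + momentPart x (momentMap K ρ) = ⊤ := by
  rw [klPart_eq_top β τ h]
  exact EReal.top_add_coe _

theorem neg_inv_mul_log_partitionFn_le {β : ℝ} (hβ : 0 < β) {τ ν : Measure K}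
    [IsProbabilityMeasure τ] [IsProbabilityMeasure ν] (h : InformationTheory.klDiv ν τ ≠ ⊤)
    (μ : SignedMeasure (Sph d)) :
    -(β⁻¹ * Real.log (partitionFn τ fun y => β * network μ y))
      ≤ β⁻¹ * (InformationTheory.klDiv ν τ).toReal
        + measureFunctional μ (momentMap K ν.toSignedMeasure) := by
  have h1 := neg_log_partitionFn_le ((continuous_network μ).const_mul β) h
  rw [integral_const_mul, integral_network] at h1
  have h2 := mul_le_mul_of_nonneg_left h1 (inv_nonneg.2 hβ.le)
  rwa [mul_add, inv_mul_cancel_left₀ hβ.ne', mul_neg] at h2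

theorem inv_mul_toReal_klDiv_gibbsMeasure {β : ℝ} (hβ : 0 < β) (τ : Measure K)
    [IsProbabilityMeasure τ] (μ : SignedMeasure (Sph d))
    [IsFiniteMeasure (gibbsMeasure τ fun y => β * network μ y)] :
    β⁻¹ * (InformationTheory.klDiv (gibbsMeasure τ fun y => β * network μ y) τ).toReal
      = -(β⁻¹ * Real.log (partitionFn τ fun y => β * network μ y))
        - measureFunctional μ (momentMap K
          (gibbsMeasure τ fun y => β * network μ y).toSignedMeasure) := by
  rw [toReal_klDiv_gibbsMeasure_left ((continuous_network μ).const_mul β), integral_const_mul,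
    integral_network, mul_sub, inv_mul_cancel_left₀ hβ.ne', mul_neg]

theorem fenchelConj_klPart {β : ℝ} (hβ : 0 < β) (τ : Measure K) [IsProbabilityMeasure τ]
    (μ : SignedMeasure (Sph d)) :
    fenchelConj (klPart β τ) ((-measureFunctional μ).toLinearMap ∘ₗ momentMap K)
      = ((β⁻¹ * Real.log (partitionFn τ fun y => β * network μ y) : ℝ) : EReal) := by
  have hℓ : ∀ ρ : SignedMeasure K, ((-measureFunctional μ).toLinearMap ∘ₗ momentMap K) ρ
      = -measureFunctional μ (momentMap K ρ) := fun _ => rfl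
  refine le_antisymm (iSup_le fun ρ => ?_) ?_
  · by_cases h : ∃ ν : ProbabilityMeasure K, (ν : Measure K).toSignedMeasure = ρ
    · obtain ⟨ν, rfl⟩ := h
      rw [klPart_toSignedMeasure]
      by_cases hkl : InformationTheory.klDiv (ν : Measure K) τ = ⊤
      · rw [coe_mul_klDiv_eq_top hβ hkl, EReal.sub_top]
        exact bot_le
      · rw [coe_mul_klDiv hkl, ← EReal.coe_sub, EReal.coe_le_coe_iff, hℓ]
        linarith [neg_inv_mul_log_partitionFn_le hβ hkl μ]
    · rw [klPart_eq_top β τ (not_exists.1 h), EReal.sub_top]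
      exact bot_le
  · have hc : Continuous fun y : K => β * network μ y := (continuous_network μ).const_mul β
    have := isProbabilityMeasure_gibbsMeasure τ hc
    refine le_iSup_of_le ((gibbsProb τ _ hc : Measure K).toSignedMeasure) (le_of_eq ?_)
    have hkl : InformationTheory.klDiv (gibbsProb τ _ hc : Measure K) τ ≠ ⊤ :=
      klDiv_gibbsMeasure_ne_top hc
    rw [klPart_toSignedMeasure, coe_mul_klDiv hkl, ← EReal.coe_sub, EReal.coe_eq_coe_iff, hℓ]
    change _ = -measureFunctional μ (momentMap K (gibbsMeasure τ _).toSignedMeasure)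
      - β⁻¹ * (InformationTheory.klDiv (gibbsMeasure τ _) τ).toReal
    rw [inv_mul_toReal_klDiv_gibbsMeasure hβ]
    ring

end Networks

/-! ### The conjugate of the distance to a point -/

theorem fenchelConj_norm_sub {E : Type*} [NormedAddCommGroup E] [NormedSpace ℝ E] (m : E)
    {L : StrongDual ℝ E} (hL : ‖L‖ ≤ 1) :
    fenchelConj (fun φ => ((‖φ - m‖ : ℝ) : EReal)) L.toLinearMap = ((L m : ℝ) : EReal) := by
  refine le_antisymm (iSup_le fun φ => ?_) (le_iSup_of_le m (by simp))
  rw [← EReal.coe_sub, EReal.coe_le_coe_iff]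
  change L φ - _ ≤ L m
  have h1 := (le_abs_self _).trans (L.le_of_opNorm_le hL (φ - m))
  rw [map_sub] at h1
  linarith

theorem fenchelConj_norm_sub_eq_top {E : Type*} [NormedAddCommGroup E] [NormedSpace ℝ E] (m : E)
    {L : StrongDual ℝ E} (hL : 1 < ‖L‖) :
    fenchelConj (fun φ => ((‖φ - m‖ : ℝ) : EReal)) L.toLinearMap = ⊤ := by
  obtain ⟨φ, hφ⟩ : ∃ φ, ‖φ‖ < L φ := by
    by_contra! h
    refine hL.not_ge (L.opNorm_le_bound zero_le_one fun φ => ?_)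
    rw [one_mul, Real.norm_eq_abs, abs_le]
    have h1 := h (-φ)
    rw [map_neg, norm_neg] at h1
    exact ⟨by linarith, h φ⟩
  refine EReal.eq_top_iff_forall_lt _ |>.2 fun r => ?_
  have hpos : 0 < L φ - ‖φ‖ := sub_pos.2 hφ
  obtain ⟨t, ht⟩ := exists_nat_gt ((r - L m) / (L φ - ‖φ‖))
  rw [div_lt_iff₀ hpos] at ht
  refine lt_of_lt_of_le ?_ (le_iSup _ (m + (t : ℝ) • φ))
  rw [← EReal.coe_sub, EReal.coe_lt_coe_iff]
  change r < L _ - _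
  rw [map_add, map_smul, add_sub_cancel_left, norm_smul, Real.norm_natCast, smul_eq_mul]
  linarith

section Duality

variable {d : ℕ} {K : Set (Space d)}

theorem nonempty_sphere (d : ℕ) : Nonempty (Sph d) :=
  (NormedSpace.sphere_nonempty.2 zero_le_one).to_subtype

theorem mem_tvBall_iff_norm_le {μ : SignedMeasure (Sph d)} :
    μ ∈ tvBall d ↔ ‖measureFunctional μ‖ ≤ 1 := by
  have := nonempty_sphere d
  rw [norm_measureFunctional]
  rfl

/-! ### The ball of `F_1` -/

/-- The infimum in the `F_1` norm is attained. -/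
theorem exists_network_eq_of_f1Norm_le {r : ℝ} (hr : 0 ≤ r) {f : K → ℝ}
    (hf : f1Norm f ≤ ENNReal.ofReal r) :
    ∃ γ : SignedMeasure (Sph d), tvNorm γ ≤ r ∧ ∀ y, f y = network γ y := by
  have := nonempty_sphere d
  have hlt : ∀ s, r < s → ∃ γ : SignedMeasure (Sph d), (∀ y, f y = network γ y) ∧ tvNorm γ < s := by
    intro s hs
    have h1 : f1Norm f < ENNReal.ofReal s :=
      hf.trans_lt ((ENNReal.ofReal_lt_ofReal_iff (hr.trans_lt hs)).2 hs)
    simp only [f1Norm, iInf_lt_iff] at h1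
    obtain ⟨γ, hγ, h2⟩ := h1
    exact ⟨γ, hγ, (ENNReal.ofReal_lt_ofReal_iff (hr.trans_lt hs)).1 h2⟩
  obtain ⟨γ, hγ, -⟩ := hlt (r + 1) (lt_add_one r)
  let V : Submodule ℝ C(Sph d, ℝ) := Submodule.span ℝ (Set.range (neuronMap K))
  obtain ⟨L, hL, hnorm⟩ := exists_extension_norm_eq V
    ((measureFunctional γ).comp V.subtypeL)
  obtain ⟨μ, hμ, hle⟩ := exists_measureFunctional_eq L
  refine ⟨μ, hle.trans ?_, fun y => ?_⟩
  · rw [hnorm]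
    refine le_of_forall_gt_imp_ge_of_dense fun s hs => ?_
    obtain ⟨γ', hγ', hs'⟩ := hlt s hs
    refine ContinuousLinearMap.opNorm_le_bound _ (hr.trans hs.le) fun φ => ?_
    have heq : measureFunctional γ φ = measureFunctional γ' φ := by
      refine LinearMap.eqOn_span (f := (measureFunctional γ).toLinearMap)
        (g := (measureFunctional γ').toLinearMap) ?_ φ.2
      rintro _ ⟨y, rfl⟩
      exact (hγ y).symm.trans (hγ' y)
    change ‖measureFunctional γ φ‖ ≤ _
    rw [heq]
    exact (measureFunctional γ').le_of_opNorm_le ((norm_measureFunctional γ').trans_le hs'.le) _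
  · rw [network_eq, hμ, hL ⟨_, Submodule.subset_span ⟨y, rfl⟩⟩]
    exact hγ y

theorem image_tvBall_eq_f1Ball {β : ℝ} (hβ : 0 < β) :
    (fun (μ : SignedMeasure (Sph d)) (y : K) => β * network μ y) '' tvBall d = f1Ball K β := by
  have hsmul : ∀ (c : ℝ) (μ : SignedMeasure (Sph d)) (y : K),
      network (c • μ) y = c * network μ y := fun c μ y =>
    measureFunctional_smul_apply c μ (neuronMap K y)
  ext f
  constructor
  · rintro ⟨μ, hμ, rfl⟩
    change f1Norm _ ≤ _
    rw [f1Norm]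
    refine iInf_le_of_le (β • μ) (iInf_le_of_le (fun y => (hsmul β μ y).symm)
      (ENNReal.ofReal_le_ofReal ?_))
    rw [tvNorm_smul, abs_of_pos hβ]
    exact mul_le_of_le_one_right hβ.le hμ
  · intro hf
    obtain ⟨γ, hγ, h⟩ := exists_network_eq_of_f1Norm_le hβ.le hf
    refine ⟨β⁻¹ • γ, ?_, funext fun y => ?_⟩
    · change tvNorm _ ≤ 1
      rw [tvNorm_smul, abs_of_pos (inv_pos.2 hβ)]
      exact (inv_mul_le_one₀ hβ).2 hγ
    · change β * network _ y = f y
      rw [hsmul, mul_inv_cancel_left₀ hβ.ne', h]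

/-! ### The dual objective as a Fenchel dual -/

variable [CompactSpace K] {n : ℕ} {x : Fin n → K}

theorem fenchelDualObjective_of_mem [IsFiniteMeasure (empirical x)] {β : ℝ} (hβ : 0 < β)
    (τ : Measure K) [IsProbabilityMeasure τ] {μ : SignedMeasure (Sph d)} (hμ : μ ∈ tvBall d) :
    fenchelDualObjective (klPart β τ) (momentPart x) (momentMap K) (-measureFunctional μ)
      = ((dualObjective β τ x μ : ℝ) : EReal) := by
  have h := fenchelConj_norm_sub (momentMap K (empirical x).toSignedMeasure)
    (mem_tvBall_iff_norm_le.1 hμ)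
  rw [fenchelDualObjective, fenchelConj_klPart hβ, neg_neg, funext momentPart_eq, h,
    dualObjective_eq, ← EReal.coe_neg, ← EReal.coe_sub]
  congr 1
  ring

theorem fenchelDualObjective_of_notMem [IsFiniteMeasure (empirical x)] {β : ℝ} (hβ : 0 < β)
    (τ : Measure K) [IsProbabilityMeasure τ] {μ : SignedMeasure (Sph d)} (hμ : μ ∉ tvBall d) :
    fenchelDualObjective (klPart β τ) (momentPart x) (momentMap K) (-measureFunctional μ) = ⊥ := by
  rw [mem_tvBall_iff_norm_le, not_le] at hμ
  rw [fenchelDualObjective, fenchelConj_klPart hβ, neg_neg, funext momentPart_eq,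
    fenchelConj_norm_sub_eq_top _ hμ, ← EReal.coe_neg, EReal.sub_top]

end Duality

/-! ### Strong duality -/

section StrongDuality

variable {d : ℕ} {K : Set (Space d)} {n : ℕ} {x : Fin n → K}

theorem primalObjective_eq_top {β : ℝ} (hβ : 0 < β) {τ : Measure K} {ν : ProbabilityMeasure K}
    (h : InformationTheory.klDiv (ν : Measure K) τ = ⊤) : primalObjective β τ x ν = ⊤ := by
  rw [primalObjective, coe_mul_klDiv_eq_top hβ h, EReal.top_add_coe]

variable [CompactSpace K]

theorem primalObjective_eq_coe [IsFiniteMeasure (empirical x)] {β : ℝ} {τ : Measure K}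
    {ν : ProbabilityMeasure K} (h : InformationTheory.klDiv (ν : Measure K) τ ≠ ⊤) :
    primalObjective β τ x ν = ((β⁻¹ * (InformationTheory.klDiv (ν : Measure K) τ).toReal
      + ‖momentMap K (ν : Measure K).toSignedMeasure
        - momentMap K (empirical x).toSignedMeasure‖ : ℝ) : EReal) := by
  rw [primalObjective, coe_mul_klDiv h, momentDiscrepancy_eq, EReal.coe_add]

theorem dualObjective_le_primalObjective [IsFiniteMeasure (empirical x)] {β : ℝ} (hβ : 0 < β)
    {τ : Measure K} [IsProbabilityMeasure τ] {μ : SignedMeasure (Sph d)} (hμ : μ ∈ tvBall d)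
    (ν : ProbabilityMeasure K) :
    ((dualObjective β τ x μ : ℝ) : EReal) ≤ primalObjective β τ x ν := by
  by_cases h : InformationTheory.klDiv (ν : Measure K) τ = ⊤
  · rw [primalObjective_eq_top hβ h]
    exact le_top
  · rw [primalObjective_eq_coe h, EReal.coe_le_coe_iff, dualObjective_eq]
    have h1 := neg_inv_mul_log_partitionFn_le hβ h μ
    have h2 := (le_abs_self _).trans ((measureFunctional μ).le_of_opNorm_le
      (mem_tvBall_iff_norm_le.1 hμ) (momentMap K (ν : Measure K).toSignedMeasure
        - momentMap K (empirical x).toSignedMeasure))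
    rw [map_sub] at h2
    linarith

theorem eq_gibbsMeasure_of_primalObjective_le [IsFiniteMeasure (empirical x)] {β : ℝ}
    (hβ : 0 < β) {τ : Measure K} [IsProbabilityMeasure τ] {μ : SignedMeasure (Sph d)}
    (hμ : μ ∈ tvBall d) {ν : ProbabilityMeasure K}
    (hle : primalObjective β τ x ν ≤ ((dualObjective β τ x μ : ℝ) : EReal)) :
    (ν : Measure K) = gibbsMeasure τ fun y => β * network μ y := by
  have h : InformationTheory.klDiv (ν : Measure K) τ ≠ ⊤ := fun h => by
    rw [primalObjective_eq_top hβ h] at hle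
    exact (EReal.coe_lt_top _).not_ge hle
  rw [primalObjective_eq_coe h, EReal.coe_le_coe_iff, dualObjective_eq] at hle
  have h2 := (le_abs_self _).trans ((measureFunctional μ).le_of_opNorm_le
    (mem_tvBall_iff_norm_le.1 hμ) (momentMap K (ν : Measure K).toSignedMeasure
      - momentMap K (empirical x).toSignedMeasure))
  rw [map_sub] at h2
  refine eq_gibbsMeasure_of_le ((continuous_network μ).const_mul β) h ?_
  rw [integral_const_mul, integral_network, ← sub_nonpos]
  refine nonpos_of_mul_nonpos_right (a := β⁻¹) ?_ (inv_pos.2 hβ)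
  rw [mul_sub, mul_add, inv_mul_cancel_left₀ hβ.ne', mul_neg]
  linarith

theorem tendsto_dualObjective [IsFiniteMeasure (empirical x)] {β : ℝ} (hβ : 0 < β)
    (τ : Measure K) [IsProbabilityMeasure τ] {u : ℕ → SignedMeasure (Sph d)}
    {μ : SignedMeasure (Sph d)} (hu : ∀ k, u k ∈ tvBall d)
    (h : ∀ φ, Filter.Tendsto (fun k => measureFunctional (u k) φ) Filter.atTop
      (nhds (measureFunctional μ φ))) :
    Filter.Tendsto (fun k => dualObjective β τ x (u k)) Filter.atTop
      (nhds (dualObjective β τ x μ)) := by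
  simp only [dualObjective_eq]
  refine (h _).neg.sub (Filter.Tendsto.const_mul _ (Filter.Tendsto.log ?_
    (partitionFn_pos τ ((continuous_network μ).const_mul β)).ne'))
  refine tendsto_integral_of_dominated_convergence (fun _ => Real.exp (β * ‖neuronMap K‖))
    (fun k => ?_) (integrable_const _) (fun k => Filter.Eventually.of_forall fun y => ?_)
    (Filter.Eventually.of_forall fun y => ?_)
  · exact (integrable_exp_neg τ ((continuous_network (u k)).const_mul β)).aestronglyMeasurable
  · rw [Real.norm_of_nonneg (Real.exp_nonneg _), Real.exp_le_exp, ← mul_neg]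
    refine mul_le_mul_of_nonneg_left ?_ hβ.le
    have h1 := (neg_le_abs _).trans ((measureFunctional (u k)).le_of_opNorm_le
      (mem_tvBall_iff_norm_le.1 (hu k)) (neuronMap K y))
    rw [one_mul] at h1
    exact h1.trans ((neuronMap K).norm_coe_le_norm y)
  · exact (Real.continuous_exp.tendsto _).comp (((h (neuronMap K y)).const_mul β).neg)

theorem exists_isMaxOn_dualObjective [IsFiniteMeasure (empirical x)] {β : ℝ} (hβ : 0 < β)
    (τ : Measure K) [IsProbabilityMeasure τ] :
    ∃ μ ∈ tvBall d, ∀ μ' ∈ tvBall d, dualObjective β τ x μ' ≤ dualObjective β τ x μ := by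
  have := nonempty_sphere d
  set S : Set ℝ := dualObjective β τ x '' tvBall d
  have hne : S.Nonempty := ⟨_, 0, by
    change tvNorm 0 ≤ 1
    simp [tvNorm, SignedMeasure.totalVariation_zero], rfl⟩
  have hbdd : BddAbove S := by
    have hkl : InformationTheory.klDiv ((⟨τ, inferInstance⟩ : ProbabilityMeasure K) : Measure K) τ
        ≠ ⊤ := by
      change InformationTheory.klDiv τ τ ≠ ⊤
      simp
    obtain ⟨p, hp⟩ : ∃ p : ℝ, primalObjective β τ x ⟨τ, inferInstance⟩ = p :=
      ⟨_, primalObjective_eq_coe hkl⟩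
    refine ⟨p, ?_⟩
    rintro _ ⟨μ, hμ, rfl⟩
    exact EReal.coe_le_coe_iff.1 ((dualObjective_le_primalObjective hβ hμ _).trans_eq hp)
  obtain ⟨s, -, hs, hsS⟩ := exists_seq_tendsto_sSup hne hbdd
  choose u hu hus using hsS
  obtain ⟨L, hL, φ, hφ, hlim⟩ := WeakDual.isSeqCompact_closedBall ℝ C(Sph d, ℝ) 0 1
    (x := fun k => StrongDual.toWeakDual (measureFunctional (u k))) fun k => by
      simpa using mem_tvBall_iff_norm_le.1 (hu k)
  obtain ⟨μ, hμ, -⟩ := exists_measureFunctional_eq (WeakDual.toStrongDual L)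
  refine ⟨μ, mem_tvBall_iff_norm_le.2 (by rw [hμ]; simpa using hL), fun μ' hμ' => ?_⟩
  have h1 : Filter.Tendsto (fun k => dualObjective β τ x (u (φ k))) Filter.atTop
      (nhds (dualObjective β τ x μ)) := by
    refine tendsto_dualObjective hβ τ (fun k => hu (φ k)) fun ψ => ?_
    rw [hμ]
    exact ((WeakDual.eval_continuous ψ).tendsto L).comp hlim
  simp only [hus] at h1
  rw [tendsto_nhds_unique h1 (hs.comp hφ.tendsto_atTop)]
  exact le_csSup hbdd ⟨μ', hμ', rfl⟩

/-- The first order optimality condition for the dual problem. -/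
theorem norm_moment_sub_le_of_isMaxOn [IsFiniteMeasure (empirical x)] {β : ℝ} (hβ : 0 < β)
    {τ : Measure K} [IsProbabilityMeasure τ] {μ : SignedMeasure (Sph d)} (hμ : μ ∈ tvBall d)
    (hmax : ∀ μ' ∈ tvBall d, dualObjective β τ x μ' ≤ dualObjective β τ x μ)
    [IsFiniteMeasure (gibbsMeasure τ fun y => β * network μ y)] :
    ‖momentMap K (gibbsMeasure τ fun y => β * network μ y).toSignedMeasure
        - momentMap K (empirical x).toSignedMeasure‖
      ≤ measureFunctional μ (momentMap K (gibbsMeasure τ fun y => β * network μ y).toSignedMeasure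
        - momentMap K (empirical x).toSignedMeasure) := by
  have := nonempty_sphere d
  set G := momentMap K (gibbsMeasure τ fun y => β * network μ y).toSignedMeasure
  set m := momentMap K (empirical x).toSignedMeasure
  obtain ⟨L, hL, hLψ⟩ := exists_dual_vector'' ℝ (G - m)
  obtain ⟨μ', rfl, -⟩ := exists_measureFunctional_eq L
  let δ : SignedMeasure (Sph d) := μ' + (-1 : ℝ) • μ
  have hδ : ∀ φ, measureFunctional δ φ = measureFunctional μ' φ - measureFunctional μ φ := fun φ => by
    rw [measureFunctional_add_apply, measureFunctional_smul_apply]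
    ring
  have hline : ∀ (t : ℝ) (φ), measureFunctional (μ + t • δ) φ
      = measureFunctional μ φ + t * measureFunctional δ φ := fun t φ => by
    rw [measureFunctional_add_apply, measureFunctional_smul_apply]
  have hF : ∀ t : ℝ, dualObjective β τ x (μ + t • δ)
      = -(measureFunctional μ m + t * measureFunctional δ m) - β⁻¹ *
        Real.log (partitionFn τ fun y => β * network μ y + t * (β * network δ y)) := fun t => by
    rw [dualObjective_eq, hline]
    congr 4
    ext y
    rw [network_eq, hline, network_eq, network_eq]
    ring
  have hder : HasDerivAt (fun t : ℝ => dualObjective β τ x (μ + t • δ))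
      (measureFunctional δ (G - m)) 0 := by
    rw [funext hF]
    have h1 := (hasDerivAt_log_partitionFn (τ := τ) ((continuous_network (K := K) μ).const_mul β)
      ((continuous_network (K := K) δ).const_mul β)).const_mul β⁻¹
    have h2 := (((hasDerivAt_id (0 : ℝ)).mul_const (measureFunctional δ m)).const_add
      (measureFunctional μ m)).neg.sub h1
    refine h2.congr_deriv ?_
    rw [integral_const_mul, integral_network, map_sub, mul_neg, inv_mul_cancel_left₀ hβ.ne']
    ring
  have hle := HasDerivAt.nonpos_of_forall_le hder fun t ht => by
    rw [zero_smul, add_zero]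
    refine hmax _ (mem_tvBall_iff_norm_le.2
      (ContinuousLinearMap.opNorm_le_bound _ zero_le_one fun φ => ?_))
    have h1 := (measureFunctional μ).le_of_opNorm_le (mem_tvBall_iff_norm_le.1 hμ) φ
    have h2 := (measureFunctional μ').le_of_opNorm_le hL φ
    rw [hline, hδ]
    calc |measureFunctional μ φ + t * (measureFunctional μ' φ - measureFunctional μ φ)|
        = |(1 - t) * measureFunctional μ φ + t * measureFunctional μ' φ| := by congr 1; ring
      _ ≤ (1 - t) * |measureFunctional μ φ| + t * |measureFunctional μ' φ| := by
        refine (abs_add_le _ _).trans_eq ?_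
        rw [abs_mul, abs_mul, abs_of_nonneg (sub_nonneg.2 ht.2), abs_of_pos ht.1]
      _ ≤ (1 - t) * (1 * ‖φ‖) + t * (1 * ‖φ‖) :=
        add_le_add (mul_le_mul_of_nonneg_left h1 (sub_nonneg.2 ht.2))
          (mul_le_mul_of_nonneg_left h2 ht.1.le)
      _ = 1 * ‖φ‖ := by ring
  rw [hδ, hLψ] at hle
  exact sub_nonpos.1 hle

/-- The Gibbs measure of a solution of the dual problem closes the duality gap. -/
theorem primalObjective_gibbsProb [IsFiniteMeasure (empirical x)] {β : ℝ} (hβ : 0 < β)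
    {τ : Measure K} [IsProbabilityMeasure τ] {μ : SignedMeasure (Sph d)} (hμ : μ ∈ tvBall d)
    (hmax : ∀ μ' ∈ tvBall d, dualObjective β τ x μ' ≤ dualObjective β τ x μ) :
    primalObjective β τ x (gibbsProb τ _ ((continuous_network μ).const_mul β))
      = ((dualObjective β τ x μ : ℝ) : EReal) := by
  have hc : Continuous fun y : K => β * network μ y := (continuous_network μ).const_mul β
  have := isProbabilityMeasure_gibbsMeasure τ hc
  refine le_antisymm ?_ (dualObjective_le_primalObjective hβ hμ _)
  have hkl : InformationTheory.klDiv (gibbsProb τ _ hc : Measure K) τ ≠ ⊤ :=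
    klDiv_gibbsMeasure_ne_top hc
  rw [primalObjective_eq_coe hkl, EReal.coe_le_coe_iff, dualObjective_eq]
  have h1 := norm_moment_sub_le_of_isMaxOn hβ hμ hmax
  have h2 := inv_mul_toReal_klDiv_gibbsMeasure hβ τ μ
  rw [map_sub] at h1
  change β⁻¹ * (InformationTheory.klDiv (gibbsMeasure τ _) τ).toReal
    + ‖momentMap K (gibbsMeasure τ _).toSignedMeasure - _‖ ≤ _
  linarith

end StrongDuality

end F1Duality

open F1Duality in
theorem mainTheorem8 (d : ℕ) (K : Set (Space d)) [CompactSpace K]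
    (τ : Measure K) [IsProbabilityMeasure τ] (β : ℝ) (hβ : 0 < β)
    (n : ℕ) (hn : 0 < n) (x : Fin n → K) :
    -- the second problem is the Fenchel dual of the first one, with `M(𝕊^d) = C(𝕊^d)*`
    (∀ ν : ProbabilityMeasure K,
      klPart β τ (ν : Measure K).toSignedMeasure
        + momentPart x (momentMap K (ν : Measure K).toSignedMeasure) = primalObjective β τ x ν) ∧
    (∀ ρ : SignedMeasure K, (∀ ν : ProbabilityMeasure K, (ν : Measure K).toSignedMeasure ≠ ρ) →
      klPart β τ ρ + momentPart x (momentMap K ρ) = ⊤) ∧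
    Function.Bijective
      (measureFunctional : SignedMeasure (Sph d) → StrongDual ℝ C(Sph d, ℝ)) ∧
    (∀ μ : SignedMeasure (Sph d), μ ∈ tvBall d →
      fenchelDualObjective (klPart β τ) (momentPart x) (momentMap K) (-measureFunctional μ)
        = ((dualObjective β τ x μ : ℝ) : EReal)) ∧
    (∀ μ : SignedMeasure (Sph d), μ ∉ tvBall d →
      fenchelDualObjective (klPart β τ) (momentPart x) (momentMap K) (-measureFunctional μ)
        = ⊥) ∧
    -- the second problem is maximum likelihood over the ball of radius `β` of `F_1`
    (fun (μ : SignedMeasure (Sph d)) (y : K) => β * network μ y) '' tvBall d = f1Ball K β ∧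
    (∀ μ : SignedMeasure (Sph d), dualObjective β τ x μ
      = -(β⁻¹ * crossEntropy τ (empirical x) fun y => β * network μ y)) ∧
    -- strong duality, with both optima attained
    (∃ p : ℝ, IsLeast (Set.range (primalObjective β τ x)) (p : EReal) ∧
      IsGreatest (dualObjective β τ x '' tvBall d) p) ∧
    -- the solution of the first problem is unique, and it is a Gibbs measure
    (∃! ν : ProbabilityMeasure K,
      ∀ ν' : ProbabilityMeasure K, primalObjective β τ x ν ≤ primalObjective β τ x ν') ∧
    (∀ (ν : ProbabilityMeasure K) (μ : SignedMeasure (Sph d)),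
      (∀ ν' : ProbabilityMeasure K, primalObjective β τ x ν ≤ primalObjective β τ x ν') →
      μ ∈ tvBall d → (∀ μ' ∈ tvBall d, dualObjective β τ x μ' ≤ dualObjective β τ x μ) →
      (ν : Measure K) = gibbsMeasure τ fun y => β * network μ y) := by
  have hemp := isProbabilityMeasure_empirical hn x
  have hsph := nonempty_sphere d
  obtain ⟨μ₀, hμ₀, hmax₀⟩ := exists_isMaxOn_dualObjective (x := x) hβ τ
  have hopt := primalObjective_gibbsProb hβ hμ₀ hmax₀
  refine ⟨klPart_add_momentPart β τ, fun ρ => klPart_add_momentPart_eq_top β τ,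
    measureFunctional_bijective, fun μ => fenchelDualObjective_of_mem hβ τ,
    fun μ => fenchelDualObjective_of_notMem hβ τ, image_tvBall_eq_f1Ball hβ,
    dualObjective_eq_neg_crossEntropy hβ τ,
    ⟨dualObjective β τ x μ₀, ⟨⟨_, hopt⟩, ?_⟩, ⟨μ₀, hμ₀, rfl⟩, ?_⟩,
    ⟨gibbsProb τ _ ((continuous_network μ₀).const_mul β), fun ν => ?_, fun ν hν => ?_⟩,
    fun ν μ hν hμ hmax => ?_⟩
  · rintro _ ⟨ν, rfl⟩
    exact dualObjective_le_primalObjective hβ hμ₀ ν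
  · rintro _ ⟨μ, hμ, rfl⟩
    exact hmax₀ μ hμ
  · exact hopt.trans_le (dualObjective_le_primalObjective hβ hμ₀ ν)
  · exact Subtype.ext (eq_gibbsMeasure_of_primalObjective_le hβ hμ₀ ((hν _).trans_eq hopt))
  · exact eq_gibbsMeasure_of_primalObjective_le hβ hμ
      ((hν _).trans_eq (primalObjective_gibbsProb hβ hμ hmax))
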